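/- Let $H \ge 0$ be an integer, let $d_0, d_1, \dots, d_{H+1}$ be layer widths, and write $d_x = d_0$, $d_y = d_{H+1}$. Suppose $d_j \ge \min\{d_x, d_y\}$ for all $j \in \{1,\dots,H\}$. Let $\ell_0 : \mathbb{R}^{d_y \times d_x} \to \mathbb{R}$ be differentiable, and for tuples of matrices $W_j \in \mathbb{R}^{d_j \times d_{j-1}}$ ($1 \le j \le H+1$) define the deep linear loss $$\ell\big((W_j)_{j=1}^{H+1}\big) = \ell_0(W_{H+1} W_H \cdots W_1).$$ A saddle is a critical point that is neither a local minimum nor a local maximum. Assume that every critical point of $\ell_0$ is a global minimum of $\ell_0$. Then for every critical point $(\hat W_j)_{j=1}^{H+1}$ of $\ell$: - if $\nabla \ell_0(\hat W_{H+1} \cdots \hat W_1) \ne 0$, then $(\hat W_j)_{j=1}^{H+1}$ is a saddle of $\ell$; - if $\nabla \ell_0(\hat W_{H+1} \cdots \hat W_1) = 0$, then $(\hat W_j)_{j=1}^{H+1}$ is a global minimum of $\ell$. The same statement holds with "global minimum" replaced by "global maximum" in both the assumption on $\ell_0$ and the conclusion. -/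

import Mathlib

/-- The weights of a linear network of depth `n` with layer widths `d 0, …, d n`: with zero-based
indices, the matrix `W j` maps layer `j` (of width `d j`) to layer `j + 1` (of width `d (j + 1)`).
Only the first `n + 1` values of `d` matter. -/
abbrev LinearNetWeights (d : ℕ → ℕ) (n : ℕ) : Type :=
  (j : Fin n) → Matrix (Fin (d ((j : ℕ) + 1))) (Fin (d (j : ℕ))) ℝ

/-- The product `W (n-1) * ⋯ * W 1 * W 0` of all weight matrices, last layer leftmost
(the identity for `n = 0`). -/
def weightProd (d : ℕ → ℕ) :
    (n : ℕ) → LinearNetWeights d n → Matrix (Fin (d n)) (Fin (d 0)) ℝ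
  | 0, _ => 1
  | n + 1, W =>
      (W ⟨n, n.lt_succ_self⟩ : Matrix (Fin (d (n + 1))) (Fin (d n)) ℝ) *
        weightProd d n (fun j => W j.castSucc)

/-- The loss `ℓ(W) = ℓ₀(W_{H+1} ⋯ W_1)` of a linear network with `H` hidden layers. -/
def deepLinearLoss (d : ℕ → ℕ) (H : ℕ) (ℓ₀ : Matrix (Fin (d (H + 1))) (Fin (d 0)) ℝ → ℝ)
    (W : LinearNetWeights d (H + 1)) : ℝ :=
  ℓ₀ (weightProd d (H + 1) W)

/-- The gradient of a function of an `m × n` real matrix, as the `m × n` matrix of its partial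
derivatives with respect to the entries. -/
noncomputable def matrixGradient {m n : ℕ} (f : Matrix (Fin m) (Fin n) ℝ → ℝ)
    (M : Matrix (Fin m) (Fin n) ℝ) : Matrix (Fin m) (Fin n) ℝ :=
  Matrix.of fun i j => fderiv ℝ f M (Matrix.single i j 1)

/-- `x` is a critical point of `f`: `f` is differentiable at `x` with zero derivative. -/
def IsCriticalPt {E : Type*} [AddCommGroup E] [Module ℝ E] [TopologicalSpace E]
    (f : E → ℝ) (x : E) : Prop :=
  HasFDerivAt f (0 : E →L[ℝ] ℝ) x

/-- A saddle: a critical point that is neither a local minimum nor a local maximum. -/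
def IsSaddlePt {E : Type*} [AddCommGroup E] [Module ℝ E] [TopologicalSpace E]
    (f : E → ℝ) (x : E) : Prop :=
  IsCriticalPt f x ∧ ¬ IsLocalMin f x ∧ ¬ IsLocalMax f x

/-- `x` is a global minimum point of `f`. -/
def IsGlobalMin {E : Type*} (f : E → ℝ) (x : E) : Prop := ∀ y, f x ≤ f y

/-- `x` is a global maximum point of `f`. -/
def IsGlobalMax {E : Type*} (f : E → ℝ) (x : E) : Prop := ∀ y, f y ≤ f x

open Filter Topology Matrix

section LinearAlgebra

variable {m n p : ℕ}

/-! The substance is that a local minimum `W` of the deep loss has `D = 0`, where `D` is the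
derivative of `ℓ₀` at the end-to-end product; maxima follow by negation. Stationarity in layer `j`
gives `D (A * M * B) = 0` for all `M`, with `A`, `B` the products of the later and earlier layers.
If `d 0 ≤ d n`, `A` is peeled off layer by layer: when `B` has a left inverse, it is cancelled;
otherwise `B` has a left null vector, along which layer `j` can move without changing the product.
Small such moves stay local minima (`exists_update`), and comparing two of them removes one more
layer. The case `d n ≤ d 0` is the mirror image. -/

theorem exists_left_inverse_or_exists_mulVec_eq_zero (B : Matrix (Fin m) (Fin n) ℝ) :
    (∃ L : Matrix (Fin n) (Fin m) ℝ, L * B = 1) ∨ ∃ u, u ≠ 0 ∧ B *ᵥ u = 0 := by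
  by_cases h : ∃ u, u ≠ 0 ∧ B *ᵥ u = 0
  · exact Or.inr h
  · left
    push Not at h
    have hker : LinearMap.ker (Matrix.toLin' B) = ⊥ := by
      rw [LinearMap.ker_eq_bot']
      intro u hu
      by_contra hne
      exact h u hne (by simpa using hu)
    obtain ⟨g, hg⟩ := LinearMap.exists_leftInverse_of_injective _ hker
    refine ⟨LinearMap.toMatrix' g, ?_⟩
    have := congrArg LinearMap.toMatrix' hg
    simpa [LinearMap.toMatrix'_comp] using this

/-- Otherwise `B` has a right inverse, so `m ≤ n`; then `B` is square and invertible, contradicting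
`B *ᵥ u = 0`. -/
theorem exists_vecMul_eq_zero_of_mulVec_eq_zero (hnm : n ≤ m) {B : Matrix (Fin m) (Fin n) ℝ}
    {u : Fin n → ℝ} (hu : u ≠ 0) (hBu : B *ᵥ u = 0) : ∃ v, v ≠ 0 ∧ v ᵥ* B = 0 := by
  rcases exists_left_inverse_or_exists_mulVec_eq_zero Bᵀ with ⟨L, hL⟩ | ⟨v, hv, hBv⟩
  · exfalso
    have hR : B * Lᵀ = 1 := by
      simpa using congrArg Matrix.transpose hL
    have hmn : m ≤ n := by
      have h := Matrix.rank_mul_le_left B Lᵀ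
      rw [hR, Matrix.rank_one, Fintype.card_fin] at h
      exact h.trans (Matrix.rank_le_width B)
    have hRB : Lᵀ * B = 1 :=
      (Matrix.mul_eq_one_comm_of_card_eq _ _ _ (by simp [le_antisymm hmn hnm])).1 hR
    apply hu
    rw [← Matrix.one_mulVec u, ← hRB, ← Matrix.mulVec_mulVec, hBu, Matrix.mulVec_zero]
  · exact ⟨v, hv, by simpa [Matrix.mulVec_transpose] using hBv⟩

theorem map_mul_mul_eq_zero_of_single {q : ℕ} (D : Matrix (Fin m) (Fin n) ℝ →ₗ[ℝ] ℝ)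
    (A : Matrix (Fin m) (Fin p) ℝ) (B : Matrix (Fin q) (Fin n) ℝ)
    (h : ∀ (a : Fin p) (b : Fin q), D (A * Matrix.single a b (1 : ℝ) * B) = 0) (Y : Matrix (Fin p) (Fin q) ℝ) :
    D (A * Y * B) = 0 := by
  rw [Matrix.matrix_eq_sum_single Y, Matrix.mul_sum, Matrix.sum_mul, map_sum]
  refine Finset.sum_eq_zero fun a _ => ?_
  rw [Matrix.mul_sum, Matrix.sum_mul, map_sum]
  refine Finset.sum_eq_zero fun b _ => ?_
  have : Matrix.single a b (Y a b) = Y a b • Matrix.single a b (1 : ℝ) := by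
    simp [Matrix.smul_single]
  rw [this, Matrix.mul_smul, Matrix.smul_mul, map_smul, h, smul_zero]

theorem vecMulVec_mul_single {v : Fin m → ℝ} {c : Fin m} (hc : v c ≠ 0) (a : Fin n) (b : Fin p) :
    Matrix.vecMulVec (Pi.single a 1) v * Matrix.single c b (v c)⁻¹ = Matrix.single a b (1 : ℝ) := by
  ext i j
  by_cases hi : i = a <;> by_cases hj : j = b <;>
    simp_all [Matrix.mul_apply, Matrix.vecMulVec_apply, Matrix.single_apply, eq_comm]

theorem single_mul_vecMulVec {v : Fin m → ℝ} {c : Fin m} (hc : v c ≠ 0) (a : Fin n) (b : Fin p) :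
    Matrix.single a c (v c)⁻¹ * Matrix.vecMulVec v (Pi.single b 1) = Matrix.single a b (1 : ℝ) := by
  ext i j
  by_cases hi : i = a <;> by_cases hj : j = b <;>
    simp_all [Matrix.mul_apply, Matrix.vecMulVec_apply, Matrix.single_apply, eq_comm]

end LinearAlgebra

theorem HasFDerivAt.apply_eq_zero_of_eventually_le {E : Type*} [NormedAddCommGroup E]
    [NormedSpace ℝ E] {f : E → ℝ} {D : E →L[ℝ] ℝ} {x v : E} (hf : HasFDerivAt f D x)
    (h : ∀ᶠ t : ℝ in 𝓝 0, f x ≤ f (x + t • v)) : D v = 0 := by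
  have hl : HasDerivAt (fun t : ℝ => f (x + t • v)) (D v) 0 := hf.hasLineDerivAt v
  refine IsLocalMin.hasDerivAt_eq_zero ?_ hl
  filter_upwards [h] with t ht
  simpa using ht

theorem HasFDerivAt.apply_matrix_eq_zero_of_eventually_le {m n : ℕ}
    {f : Matrix (Fin m) (Fin n) ℝ → ℝ} {D : Matrix (Fin m) (Fin n) ℝ →L[ℝ] ℝ}
    {x v : Matrix (Fin m) (Fin n) ℝ} (hf : HasFDerivAt f D x)
    (h : ∀ᶠ t : ℝ in 𝓝 0, f x ≤ f (x + t • v)) : D v = 0 := by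
  -- Matrices are viewed as iterated functions, to use the sup norm there.
  let E := Fin m → Fin n → ℝ
  exact HasFDerivAt.apply_eq_zero_of_eventually_le (E := E) (f := f) (D := D) (x := x) (v := v) hf h

theorem HasFDerivAt.matrix_neg {m n : ℕ}
    {f : Matrix (Fin m) (Fin n) ℝ → ℝ} {D : Matrix (Fin m) (Fin n) ℝ →L[ℝ] ℝ}
    {x : Matrix (Fin m) (Fin n) ℝ} (hf : HasFDerivAt f D x) :
    HasFDerivAt (fun y => -f y) (-D) x := by
  let E := Fin m → Fin n → ℝ
  exact HasFDerivAt.fun_neg (E := E) (f := f) (f' := D) (x := x) hf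

theorem matrixGradient_eq_zero_iff {m n : ℕ} (f : Matrix (Fin m) (Fin n) ℝ → ℝ)
    (M : Matrix (Fin m) (Fin n) ℝ) : matrixGradient f M = 0 ↔ fderiv ℝ f M = 0 := by
  refine ⟨fun h => ?_, fun h => by ext i j; simp [matrixGradient, h]⟩
  ext Y
  have := map_mul_mul_eq_zero_of_single (fderiv ℝ f M).toLinearMap 1 1
    (fun a b => by simpa [matrixGradient] using congrFun (congrFun h a) b) Y
  simpa using this

/-! ### Partial products of consecutive layers -/

section Segments

variable {d : ℕ → ℕ}

/-- Weights of a linear network of unbounded depth. -/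
abbrev WeightSeq (d : ℕ → ℕ) : Type := (j : ℕ) → Matrix (Fin (d (j + 1))) (Fin (d j)) ℝ

/-- The product `V (k - 1) * ⋯ * V i`, for `i ≤ k`; for `k = i` it is the identity. -/
def segProd (V : WeightSeq d) (i : ℕ) : (k : ℕ) → Matrix (Fin (d k)) (Fin (d i)) ℝ
  | 0 => Matrix.of fun a b => if (a : ℕ) = b then 1 else 0
  | k + 1 => if i ≤ k then V k * segProd V i k else
      Matrix.of fun a b => if (a : ℕ) = b then 1 else 0

/-- Comparing indices as naturals makes the fallback value typecheck for all `i`, `k`; it is the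
identity at `k = i`. -/
theorem segProd_self (V : WeightSeq d) (i : ℕ) : segProd V i i = 1 := by
  cases i <;> ext a b <;> simp [segProd, Matrix.one_apply, Fin.ext_iff]

theorem segProd_succ (V : WeightSeq d) {i k : ℕ} (h : i ≤ k) :
    segProd V i (k + 1) = V k * segProd V i k := by
  simp [segProd, h]

theorem segProd_eq_mul_mul (V : WeightSeq d) {i j k : ℕ} (hij : i ≤ j) (hjk : j < k) :
    segProd V i k = segProd V (j + 1) k * V j * segProd V i j := by
  induction k, hjk using Nat.le_induction with
  | base => rw [segProd_succ V hij, segProd_self, Matrix.one_mul]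
  | succ k hk ih =>
    rw [segProd_succ V (by omega : i ≤ k), segProd_succ V (by omega : j + 1 ≤ k), ih]
    simp only [Matrix.mul_assoc]

theorem segProd_congr {V V' : WeightSeq d} {i k : ℕ} (hik : i ≤ k)
    (h : ∀ j, i ≤ j → j < k → V j = V' j) : segProd V i k = segProd V' i k := by
  induction k, hik using Nat.le_induction with
  | base => rw [segProd_self, segProd_self]
  | succ k hk ih =>
    rw [segProd_succ V hk, segProd_succ V' hk, h k hk (by omega),
      ih fun j hj hjk => h j hj (by omega)]

theorem segProd_update_right (V : WeightSeq d) {i j : ℕ} (h : i ≤ j) (X) :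
    segProd (Function.update V j X) i j = segProd V i j :=
  segProd_congr h fun a _ ha => Function.update_of_ne (by omega) _ _

theorem segProd_update_left (V : WeightSeq d) {j k : ℕ} (h : j < k) (X) :
    segProd (Function.update V j X) (j + 1) k = segProd V (j + 1) k :=
  segProd_congr h fun a ha _ => Function.update_of_ne (by omega) _ _

theorem segProd_update_add_smul (V : WeightSeq d) {i j k : ℕ} (hij : i ≤ j) (hjk : j < k)
    (t : ℝ) (M) :
    segProd (Function.update V j (V j + t • M)) i k =
      segProd V i k + t • (segProd V (j + 1) k * M * segProd V i j) := by
  rw [segProd_eq_mul_mul _ hij hjk, segProd_update_left V hjk, segProd_update_right V hij,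
    segProd_eq_mul_mul V hij hjk, Function.update_self, Matrix.mul_add, Matrix.add_mul,
    Matrix.mul_smul, Matrix.smul_mul]

theorem weightProd_eq_segProd (V : WeightSeq d) (n : ℕ) :
    weightProd d n (fun j => V j) = segProd V 0 n := by
  induction n with
  | zero => rw [segProd_self]; rfl
  | succ n ih => rw [segProd_succ V n.zero_le, ← ih]; rfl

end Segments

/-! ### Local minima sharing one end-to-end product -/

section LocalMinima

variable {d : ℕ → ℕ} {n : ℕ} {f : Matrix (Fin (d n)) (Fin (d 0)) ℝ → ℝ} {V : WeightSeq d}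

/-- `V` is a local minimum of the loss `f (V (n - 1) * ⋯ * V 0)` with end-to-end matrix `P`. -/
def IsFiberLocalMin (f : Matrix (Fin (d n)) (Fin (d 0)) ℝ → ℝ)
    (P : Matrix (Fin (d n)) (Fin (d 0)) ℝ) (V : WeightSeq d) : Prop :=
  segProd V 0 n = P ∧ IsLocalMin (fun U : WeightSeq d => f (segProd U 0 n)) V

theorem tendsto_update_add_smul (V : WeightSeq d) (j : ℕ)
    (M : Matrix (Fin (d (j + 1))) (Fin (d j)) ℝ) :
    Tendsto (fun t : ℝ => Function.update V j (V j + t • M)) (𝓝 0) (𝓝 V) := by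
  have hc : Continuous fun t : ℝ => Function.update V j (V j + t • M) :=
    continuous_const.update j (by fun_prop)
  simpa using hc.tendsto 0

variable {P : Matrix (Fin (d n)) (Fin (d 0)) ℝ} {D : Matrix (Fin (d n)) (Fin (d 0)) ℝ →L[ℝ] ℝ}

theorem IsFiberLocalMin.fderiv_apply_eq_zero (h : IsFiberLocalMin f P V)
    (hf : HasFDerivAt f D P) {j : ℕ} (hj : j < n)
    (M : Matrix (Fin (d (j + 1))) (Fin (d j)) ℝ) :
    D (segProd V (j + 1) n * M * segProd V 0 j) = 0 := by
  refine hf.apply_matrix_eq_zero_of_eventually_le ?_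
  filter_upwards [(tendsto_update_add_smul V j M).eventually h.2] with t ht
  simpa only [segProd_update_add_smul V j.zero_le hj, h.1] using ht

/-- Any point close to a local minimum and with the same value is itself a local minimum. -/
theorem IsFiberLocalMin.exists_update (h : IsFiberLocalMin f P V) {j : ℕ} (hj : j < n)
    {M : Matrix (Fin (d (j + 1))) (Fin (d j)) ℝ}
    (hM : segProd V (j + 1) n * M * segProd V 0 j = 0) :
    ∃ t : ℝ, t ≠ 0 ∧ IsFiberLocalMin f P (Function.update V j (V j + t • M)) := by
  have hev := ((tendsto_update_add_smul V j M).eventually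
    (eventually_eventually_nhds.2 h.2)).filter_mono (nhdsWithin_le_nhds (s := {(0 : ℝ)}ᶜ))
  obtain ⟨t, ht, hne⟩ := (hev.and self_mem_nhdsWithin).exists
  have hP : segProd (Function.update V j (V j + t • M)) 0 n = segProd V 0 n := by
    rw [segProd_update_add_smul V j.zero_le hj, hM, smul_zero, add_zero]
  refine ⟨t, hne, hP.trans h.1, ?_⟩
  filter_upwards [ht] with U hU
  simpa only [hP] using hU

/-- The induction on `j` ranges over all `V` with product `P`, since the step uses the hypothesis at
a perturbed `V` too. -/
theorem IsFiberLocalMin.fderiv_segProd_mul_eq_zero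
    (hwidth : ∀ j, 1 ≤ j → j < n → d 0 ≤ d j) (hf : HasFDerivAt f D P) {j : ℕ} (hj : 1 ≤ j) :
    j ≤ n → ∀ {V : WeightSeq d}, IsFiberLocalMin f P V → ∀ X : Matrix (Fin (d j)) (Fin (d 0)) ℝ,
      D (segProd V j n * X) = 0 := by
  induction j, hj using Nat.le_induction with
  | base =>
    intro hn V hV X
    have := hV.fderiv_apply_eq_zero hf hn X
    rwa [segProd_self, Matrix.mul_one] at this
  | succ j hj ih =>
    intro hjn V hV X
    rcases exists_left_inverse_or_exists_mulVec_eq_zero (segProd V 0 j) with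
      ⟨L, hL⟩ | ⟨u, hu, hBu⟩
    · have := hV.fderiv_apply_eq_zero hf hjn (X * L)
      rwa [Matrix.mul_assoc, Matrix.mul_assoc, hL, Matrix.mul_one] at this
    · obtain ⟨v, hv, hvB⟩ := exists_vecMul_eq_zero_of_mulVec_eq_zero (hwidth j hj hjn) hu hBu
      obtain ⟨c, hc⟩ := Function.ne_iff.1 hv
      suffices h : ∀ (a : Fin (d (j + 1))) (b : Fin (d 0)),
          D (segProd V (j + 1) n * Matrix.single a b (1 : ℝ)) = 0 by
        simpa using map_mul_mul_eq_zero_of_single D.toLinearMap _ 1 (by simpa using h) X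
      intro a b
      obtain ⟨t, ht, hV'⟩ := hV.exists_update hjn (M := Matrix.vecMulVec (Pi.single a 1) v) (by
        rw [Matrix.mul_assoc, Matrix.vecMulVec_mul, hvB]
        ext
        simp [Matrix.mul_apply, Matrix.vecMulVec_apply])
      -- The difference of the hypotheses at the perturbed and original weights is `t` times the
      -- goal: this test matrix turns the rank-one move into `single a b 1`.
      have h1 := ih (by omega) hV' (Matrix.single c b (v c)⁻¹)
      rw [segProd_update_add_smul V le_rfl hjn, segProd_self, Matrix.mul_one, Matrix.add_mul,
        map_add, ih (by omega) hV, zero_add, Matrix.smul_mul, map_smul, smul_eq_mul,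
        Matrix.mul_assoc, vecMulVec_mul_single hc] at h1
      simpa using (mul_eq_zero.1 h1).resolve_left ht

/-- Mirror argument from the output side; `k` counts the layers after layer `j`. -/
theorem IsFiberLocalMin.fderiv_mul_segProd_eq_zero
    (hwidth : ∀ j, 1 ≤ j → j < n → d n ≤ d j) (hf : HasFDerivAt f D P) (k : ℕ) :
    ∀ {j : ℕ}, j + k + 1 = n → ∀ {V : WeightSeq d}, IsFiberLocalMin f P V →
      ∀ X : Matrix (Fin (d n)) (Fin (d j)) ℝ, D (X * segProd V 0 j) = 0 := by
  induction k with
  | zero =>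
    rintro j rfl V hV X
    have := hV.fderiv_apply_eq_zero hf (Nat.lt_succ_self j) X
    rwa [segProd_self, Matrix.one_mul] at this
  | succ k ih =>
    intro j hjn V hV X
    have hj : j < n := by omega
    rcases exists_left_inverse_or_exists_mulVec_eq_zero (segProd V (j + 1) n)ᵀ with
      ⟨L, hL⟩ | ⟨u, hu, hAu⟩
    · have hR : segProd V (j + 1) n * Lᵀ = 1 := by
        simpa using congrArg Matrix.transpose hL
      have := hV.fderiv_apply_eq_zero hf hj (Lᵀ * X)
      rwa [← Matrix.mul_assoc, hR, Matrix.one_mul] at this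
    · obtain ⟨v, hv, hvA⟩ := exists_vecMul_eq_zero_of_mulVec_eq_zero
        (hwidth (j + 1) (by omega) (by omega)) hu hAu
      rw [Matrix.vecMul_transpose] at hvA
      obtain ⟨c, hc⟩ := Function.ne_iff.1 hv
      suffices h : ∀ (a : Fin (d n)) (b : Fin (d j)),
          D (Matrix.single a b (1 : ℝ) * segProd V 0 j) = 0 by
        simpa using map_mul_mul_eq_zero_of_single D.toLinearMap 1 _ (by simpa using h) X
      intro a b
      obtain ⟨t, ht, hV'⟩ := hV.exists_update hj (M := Matrix.vecMulVec v (Pi.single b 1)) (by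
        simp [Matrix.mul_vecMulVec, hvA])
      have h1 := ih (by omega : j + 1 + k + 1 = n) hV' (Matrix.single a c (v c)⁻¹)
      rw [segProd_update_add_smul V j.zero_le j.lt_succ_self, segProd_self, Matrix.one_mul,
        Matrix.mul_add, map_add, ih (by omega) hV, zero_add, Matrix.mul_smul, map_smul,
        smul_eq_mul, ← Matrix.mul_assoc, single_mul_vecMulVec hc] at h1
      simpa using (mul_eq_zero.1 h1).resolve_left ht

/-- At a local minimum of a linear network without bottleneck, the derivative of the underlying
differentiable function of the end-to-end matrix vanishes. -/
theorem IsFiberLocalMin.fderiv_eq_zero (hn : 0 < n)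
    (hwidth : ∀ j, 1 ≤ j → j < n → min (d 0) (d n) ≤ d j) (hf : HasFDerivAt f D P)
    (h : IsFiberLocalMin f P V) : D = 0 := by
  ext X
  rcases le_total (d 0) (d n) with hle | hle
  · have := fderiv_segProd_mul_eq_zero (by simpa [hle] using hwidth) hf hn le_rfl h X
    rwa [segProd_self, Matrix.one_mul] at this
  · have := fderiv_mul_segProd_eq_zero (by simpa [hle] using hwidth) hf (n - 1) (j := 0)
      (by omega) h X
    rwa [segProd_self, Matrix.mul_one] at this

end LocalMinima

section DeepLinearLoss

variable {d : ℕ → ℕ} {H : ℕ} {ℓ₀ : Matrix (Fin (d (H + 1))) (Fin (d 0)) ℝ → ℝ}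
  {W : LinearNetWeights d (H + 1)}

theorem matrixGradient_eq_zero_of_isLocalMin
    (hwidth : ∀ j, 1 ≤ j → j ≤ H → min (d 0) (d (H + 1)) ≤ d j) (hdiff : Differentiable ℝ ℓ₀)
    (h : IsLocalMin (deepLinearLoss d H ℓ₀) W) :
    matrixGradient ℓ₀ (weightProd d (H + 1) W) = 0 := by
  -- The zero padding is never seen by the product of the first `H + 1` layers.
  let V : WeightSeq d := fun j => if hj : j < H + 1 then W ⟨j, hj⟩ else 0
  let restr : WeightSeq d → LinearNetWeights d (H + 1) := fun U j => U j
  have hV : restr V = W := by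
    funext j
    exact dif_pos j.isLt
  have hcont : Continuous restr := continuous_pi fun j => continuous_apply (j : ℕ)
  have hprod : segProd V 0 (H + 1) = weightProd d (H + 1) W := by
    rw [← weightProd_eq_segProd, ← hV]
  have hmin : IsFiberLocalMin ℓ₀ (weightProd d (H + 1) W) V := by
    refine ⟨hprod, ?_⟩
    have ht : Tendsto restr (𝓝 V) (𝓝 W) := hV ▸ hcont.tendsto V
    filter_upwards [ht.eventually h] with U hU
    rw [hprod, ← weightProd_eq_segProd]
    exact hU
  rw [matrixGradient_eq_zero_iff]
  exact hmin.fderiv_eq_zero H.succ_pos (fun j h1 hj => hwidth j h1 (by omega))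
    (hdiff _).hasFDerivAt

theorem matrixGradient_eq_zero_of_isLocalMax
    (hwidth : ∀ j, 1 ≤ j → j ≤ H → min (d 0) (d (H + 1)) ≤ d j) (hdiff : Differentiable ℝ ℓ₀)
    (h : IsLocalMax (deepLinearLoss d H ℓ₀) W) :
    matrixGradient ℓ₀ (weightProd d (H + 1) W) = 0 := by
  have hneg := matrixGradient_eq_zero_of_isLocalMin (ℓ₀ := fun M => -ℓ₀ M) hwidth
    (fun M => (hdiff M).hasFDerivAt.matrix_neg.differentiableAt) (W := W) h.neg
  rw [matrixGradient_eq_zero_iff] at hneg ⊢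
  rw [(hdiff _).hasFDerivAt.matrix_neg.fderiv] at hneg
  exact neg_eq_zero.1 hneg

theorem isSaddlePt_of_matrixGradient_ne_zero
    (hwidth : ∀ j, 1 ≤ j → j ≤ H → min (d 0) (d (H + 1)) ≤ d j) (hdiff : Differentiable ℝ ℓ₀)
    (hcrit : IsCriticalPt (deepLinearLoss d H ℓ₀) W)
    (h : matrixGradient ℓ₀ (weightProd d (H + 1) W) ≠ 0) :
    IsSaddlePt (deepLinearLoss d H ℓ₀) W :=
  ⟨hcrit, fun hmin => h (matrixGradient_eq_zero_of_isLocalMin hwidth hdiff hmin),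
    fun hmax => h (matrixGradient_eq_zero_of_isLocalMax hwidth hdiff hmax)⟩

theorem isCriticalPt_of_matrixGradient_eq_zero {m n : ℕ} {f : Matrix (Fin m) (Fin n) ℝ → ℝ}
    (hdiff : Differentiable ℝ f) {M : Matrix (Fin m) (Fin n) ℝ} (h : matrixGradient f M = 0) :
    IsCriticalPt f M := by
  have := (hdiff M).hasFDerivAt
  rwa [(matrixGradient_eq_zero_iff f M).1 h] at this

end DeepLinearLoss

theorem corollary2 (H : ℕ) (d : ℕ → ℕ)
    (hwidth : ∀ j, 1 ≤ j → j ≤ H → min (d 0) (d (H + 1)) ≤ d j)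
    (ℓ₀ : Matrix (Fin (d (H + 1))) (Fin (d 0)) ℝ → ℝ) (hdiff : Differentiable ℝ ℓ₀) :
    ((∀ R, IsCriticalPt ℓ₀ R → IsGlobalMin ℓ₀ R) →
      ∀ W : LinearNetWeights d (H + 1), IsCriticalPt (deepLinearLoss d H ℓ₀) W →
        (matrixGradient ℓ₀ (weightProd d (H + 1) W) ≠ 0 →
          IsSaddlePt (deepLinearLoss d H ℓ₀) W) ∧
        (matrixGradient ℓ₀ (weightProd d (H + 1) W) = 0 →
          IsGlobalMin (deepLinearLoss d H ℓ₀) W)) ∧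
    ((∀ R, IsCriticalPt ℓ₀ R → IsGlobalMax ℓ₀ R) →
      ∀ W : LinearNetWeights d (H + 1), IsCriticalPt (deepLinearLoss d H ℓ₀) W →
        (matrixGradient ℓ₀ (weightProd d (H + 1) W) ≠ 0 →
          IsSaddlePt (deepLinearLoss d H ℓ₀) W) ∧
        (matrixGradient ℓ₀ (weightProd d (H + 1) W) = 0 →
          IsGlobalMax (deepLinearLoss d H ℓ₀) W)) :=
  ⟨fun hglob _ hcrit => ⟨isSaddlePt_of_matrixGradient_ne_zero hwidth hdiff hcrit,
      fun h _ => hglob _ (isCriticalPt_of_matrixGradient_eq_zero hdiff h) _⟩,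
    fun hglob _ hcrit => ⟨isSaddlePt_of_matrixGradient_ne_zero hwidth hdiff hcrit,
      fun h _ => hglob _ (isCriticalPt_of_matrixGradient_eq_zero hdiff h) _⟩⟩
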